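/- Let $n\in\mathbb{N}$, let $K\subset\mathbb{R}^n$ be a convex body, i.e. a compact convex set with nonempty interior, and let $z_1,\dots,z_n\in\mathbb{Z}^n$ be linearly independent. Put $P=\sum_{j=1}^n[0,z_j]$ (Minkowski sum of segments), and for $J\subseteq[n]=\{1,\dots,n\}$ let $L_J=\mathrm{lin}\{z_j:j\in J\}$ and $P_J=\sum_{j\in J}[0,z_j]$. Let $K|L$ denote the orthogonal projection of $K$ onto a linear subspace $L$, and let $\mathrm{vol}_d$ denote the $d$-dimensional Lebesgue measure on a $d$-dimensional linear subspace (with $\mathrm{vol}_0(\{0\})=1$). Then $$\#(K\cap\mathbb{Z}^n)\le\sum_{i=0}^n\ \sum_{J\subseteq[n],\,|J|=i}\mathrm{vol}_{n-i}\bigl(K|L_J^\perp\bigr)\,\mathrm{vol}_i(P_J).$$ Equality holds if and only if $P$ is a fundamental cell of $\mathbb{Z}^n$ (that is, up to a lattice translation, $P$ is the parallelepiped $\sum_{j=1}^n[0,b_j]$ spanned by a basis $b_1,\dots,b_n$ of the lattice $\mathbb{Z}^n$) and $K$ is a lattice parallelepiped with edges parallel to those of $P$ (that is, $K=v+\sum_{j=1}^n[0,w_j]$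 with $v,w_1,\dots,w_n\in\mathbb{Z}^n$, the $w_j$ linearly independent, and each $w_j$ a real multiple of some $z_k$). -/

import Mathlib

open scoped ENNReal Pointwise

namespace GenDavenport

/-- The standard lattice `ℤⁿ` in Euclidean space `ℝⁿ`. -/
def intLattice (n : ℕ) : Submodule ℤ (EuclideanSpace ℝ (Fin n)) :=
  Submodule.span ℤ (Set.range (EuclideanSpace.basisFun (Fin n) ℝ))

/-- A vector belongs to `ℤⁿ` if and only if all its coordinates are integers. -/
theorem mem_intLattice_iff {n : ℕ} (x : EuclideanSpace ℝ (Fin n)) :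
    x ∈ intLattice n ↔ ∀ i, ∃ m : ℤ, x i = m := by
  unfold intLattice
  rw [← OrthonormalBasis.coe_toBasis, Module.Basis.mem_span_iff_repr_mem]
  simp [eq_comm]

/-- The number of lattice points `#(S ∩ ℤⁿ)`, as an extended nonnegative number
(it is `∞` if `S` contains infinitely many lattice points). -/
noncomputable def latticeCount {n : ℕ} (S : Set (EuclideanSpace ℝ (Fin n))) : ℝ≥0∞ :=
  ((S ∩ (intLattice n : Set (EuclideanSpace ℝ (Fin n)))).encard : ℝ≥0∞)

/-- For a linear subspace `L` of dimension `d`, the `d`-dimensional volume of a set `S ⊆ L`: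
Lebesgue measure on `L`, normalized so that a cube spanned by an orthonormal basis of `L` has
measure `1`. For `d = 0` this is the counting measure on the one-point space. -/
noncomputable def volIn {n : ℕ} (L : Submodule ℝ (EuclideanSpace ℝ (Fin n)))
    (S : Set (EuclideanSpace ℝ (Fin n))) : ℝ≥0∞ :=
  (stdOrthonormalBasis ℝ L).toBasis.addHaar ((↑) ⁻¹' S : Set L)

/-- The linear hull `L_J` of the vectors `z_j`, `j ∈ J`. -/
def linHull {n : ℕ} (z : Fin n → EuclideanSpace ℝ (Fin n)) (J : Finset (Fin n)) :
    Submodule ℝ (EuclideanSpace ℝ (Fin n)) :=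
  Submodule.span ℝ (z '' (J : Set (Fin n)))

/-- The parallelepiped `P_J = ∑_{j ∈ J} [0, z_j]`, a Minkowski sum of segments. -/
def subParallelepiped {n : ℕ} (z : Fin n → EuclideanSpace ℝ (Fin n)) (J : Finset (Fin n)) :
    Set (EuclideanSpace ℝ (Fin n)) :=
  ∑ j ∈ J, segment ℝ 0 (z j)

/-- The orthogonal projection `K | L` of a set onto a linear subspace. -/
noncomputable def proj {n : ℕ} (K : Set (EuclideanSpace ℝ (Fin n)))
    (L : Submodule ℝ (EuclideanSpace ℝ (Fin n))) : Set (EuclideanSpace ℝ (Fin n)) :=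
  (fun x => L.starProjection x) '' K

/-- `S` is a fundamental cell of `ℤⁿ`: up to a lattice translation, it is the parallelepiped
`∑ j, [0, b_j]` spanned by a lattice basis `b` of `ℤⁿ`. -/
def IsFundamentalCell {n : ℕ} (S : Set (EuclideanSpace ℝ (Fin n))) : Prop :=
  ∃ (v : EuclideanSpace ℝ (Fin n)) (b : Fin n → EuclideanSpace ℝ (Fin n)),
    v ∈ intLattice n ∧ LinearIndependent ℝ b ∧
    Submodule.span ℤ (Set.range b) = intLattice n ∧
    S = v +ᵥ ∑ j, segment ℝ 0 (b j)

/-- The set `𝒬(P)` for a parallelepiped `P = ∑ j, [0, z_j]`: all (full-dimensional)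
parallelepipeds `v + ∑ j, [0, w_j]` with vertices in `ℤⁿ`, each of whose edges is parallel to
an edge of `P`. -/
def parallelFamily {n : ℕ} (z : Fin n → EuclideanSpace ℝ (Fin n)) :
    Set (Set (EuclideanSpace ℝ (Fin n))) :=
  {Q | ∃ (v : EuclideanSpace ℝ (Fin n)) (w : Fin n → EuclideanSpace ℝ (Fin n)),
    v ∈ intLattice n ∧ (∀ j, w j ∈ intLattice n) ∧ LinearIndependent ℝ w ∧
    (∀ j, ∃ k, ∃ t : ℝ, w j = t • z k) ∧
    Q = v +ᵥ ∑ j, segment ℝ 0 (w j)}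

end GenDavenport

/-! The right-hand side is `vol(K + P)` (`sum_volIn_eq_volume`). Adding a segment `[0, z_i]` to a
compact convex set lengthens every nonempty fibre parallel to `z_i` by `|z_i|`, so it adds the
volume of the shadow along `z_i` plus the segment. Iterating expands `vol(K + P)` into terms indexed
by `J`, with projections along `L_J` in place of orthogonal ones; a shear of determinant 1 converts
one into the other (`volIn_proj_mul_volIn`).

For the inequality, `P` meets every class modulo `ℤⁿ`, hence contains a measurable fundamental
domain `F` of volume 1. The disjoint translates `x + F`, for `x` a lattice point of `K`, pack `K +
P`.

If equality holds, the packing leaves no room: a lattice point `x` whose open cell `x + int P` meets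
`k + int P` for some `k ∈ K` must lie in `K` (`mem_of_latticeCount_eq`). In `z`-coordinates one can
then walk by unit steps from any lattice point of `K` to the extreme values of every coordinate,
which forces `K` to be a box with integral bounds and every lattice point to have integral
coordinates (`ContainsNearby.exists_eq_Icc`). Conversely, for a lattice basis and an integral box,
the translates `x + P` have volume 1 and cover `K + P` (`volume_le_latticeCount`). -/

namespace GenDavenport

open MeasureTheory Module Set

/-! ### Adding a coordinate segment: Fubini along one axis. -/

section Segment

variable {ι : Type*} [Fintype ι] [DecidableEq ι]

theorem indicator_one_congr {α β : Type*} {s : Set α} {t : Set β} {x : α} {y : β}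
    (h : x ∈ s ↔ y ∈ t) : s.indicator (1 : α → ℝ≥0∞) x = t.indicator 1 y := by
  by_cases hy : y ∈ t
  · rw [indicator_of_mem hy, indicator_of_mem (h.2 hy)]; rfl
  · rw [indicator_of_notMem hy, indicator_of_notMem (mt h.1 hy)]

/-- The volume of the sum of a compact convex set and a unit coordinate segment. -/
theorem volume_add_segment_single {D : Set (ι → ℝ)} (hD : IsCompact D) (hconv : Convex ℝ D)
    (i : ι) :
    volume (D + segment ℝ 0 (Pi.single i 1)) =
      volume D +
        volume ((fun y => Function.update y i 0) '' D + segment ℝ 0 (Pi.single i (1 : ℝ))) := by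
  have hseg : segment ℝ (0 : ι → ℝ) (Pi.single i 1) =
      (fun s : ℝ => Pi.single i s) '' Icc 0 1 := by
    ext y
    simp only [segment_eq_image, mem_image, mem_Icc, smul_zero, zero_add]
    constructor <;> rintro ⟨s, hs, rfl⟩ <;> exact ⟨s, hs, by ext j; simp [Pi.single_apply]⟩
  have hsegc : IsCompact (segment ℝ (0 : ι → ℝ) (Pi.single i 1)) := by
    rw [hseg]
    exact isCompact_Icc.image (continuous_single (A := fun _ : ι => ℝ) i)
  have hupd : Continuous fun y : ι → ℝ => Function.update y i (0 : ℝ) :=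
    continuous_id.update i continuous_const
  have h1 : MeasurableSet (D + segment ℝ (0 : ι → ℝ) (Pi.single i 1)) :=
    (hD.add hsegc).measurableSet
  have h2 : MeasurableSet ((fun y => Function.update y i 0) '' D +
      segment ℝ (0 : ι → ℝ) (Pi.single i 1)) :=
    ((hD.image hupd).add hsegc).measurableSet
  rw [← lintegral_indicator_one h1, ← lintegral_indicator_one h2,
    ← lintegral_indicator_one hD.measurableSet,
    ← lintegral_add_left (measurable_one.indicator hD.measurableSet)]
  refine lintegral_eq_of_lmarginal_eq {i} (measurable_one.indicator h1)
    ((measurable_one.indicator hD.measurableSet).add (measurable_one.indicator h2)) ?_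
  funext x
  rw [lmarginal_singleton, lmarginal_singleton]
  have hux : Continuous fun t : ℝ => Function.update x i t :=
    continuous_const.update i continuous_id
  -- The fibre of `D` over `x` is empty or a compact interval. The corresponding fibre of the sum is
  -- `A + [0, 1]`, and that of the shadow term is `[0, 1]` exactly when `A` is nonempty.
  set A : Set ℝ := {t | Function.update x i t ∈ D} with hA
  have hAclosed : IsClosed A := hD.isClosed.preimage hux
  have hAcompact : IsCompact A := by
    refine (hD.image (continuous_apply i)).of_isClosed_subset hAclosed fun t ht => ?_
    exact ⟨_, ht, by simp⟩
  have hAconv : Convex ℝ A := by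
    intro s hs t ht p q hp hq hpq
    have h : Function.update x i (p • s + q • t) ∈ D := by
      convert hconv hs ht hp hq hpq using 1
      ext j
      by_cases hj : j = i
      · subst hj; simp
      · simp only [Function.update_of_ne hj, Pi.add_apply, Pi.smul_apply, smul_eq_mul]
        rw [← add_mul, hpq, one_mul]
    exact h
  have e1 : ∀ t, Function.update x i t ∈ D + segment ℝ (0 : ι → ℝ) (Pi.single i 1) ↔
      t ∈ A + Icc (0 : ℝ) 1 := by
    intro t
    rw [hseg, mem_add, mem_add]
    constructor
    · rintro ⟨d, hd, _, ⟨s, hs, rfl⟩, h⟩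
      refine ⟨t - s, ?_, s, hs, by ring⟩
      have : d = Function.update x i (t - s) := by
        ext j
        have := congrFun h j
        by_cases hj : j = i
        · subst hj; simp at this ⊢; linarith
        · simpa [hj] using this
      rw [hA, mem_ofPred_eq, ← this]
      exact hd
    · rintro ⟨a, ha, s, hs, rfl⟩
      refine ⟨_, ha, _, ⟨s, hs, rfl⟩, ?_⟩
      ext j
      by_cases hj : j = i
      · subst hj; simp
      · simp [hj]
  have e2 : ∀ t, Function.update x i t ∈ (fun y => Function.update y i 0) '' D +
      segment ℝ (0 : ι → ℝ) (Pi.single i 1) ↔ A.Nonempty ∧ t ∈ Icc (0 : ℝ) 1 := by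
    intro t
    rw [hseg, mem_add]
    constructor
    · rintro ⟨_, ⟨d, hd, rfl⟩, _, ⟨s, hs, rfl⟩, h⟩
      have hts : s = t := by simpa using congrFun h i
      refine ⟨⟨d i, ?_⟩, hts ▸ hs⟩
      have : Function.update x i (d i) = d := by
        ext j
        by_cases hj : j = i
        · subst hj; simp
        · simpa [hj] using (congrFun h j).symm
      rw [hA, mem_ofPred_eq, this]
      exact hd
    · rintro ⟨⟨a, ha⟩, ht⟩
      refine ⟨_, ⟨_, ha, rfl⟩, _, ⟨t, ht, rfl⟩, ?_⟩
      ext j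
      by_cases hj : j = i
      · subst hj; simp
      · simp [hj]
  have i1 : ∀ t, (D + segment ℝ (0 : ι → ℝ) (Pi.single i 1)).indicator (1 : (ι → ℝ) → ℝ≥0∞)
      (Function.update x i t) = (A + Icc (0 : ℝ) 1).indicator 1 t :=
    fun t => indicator_one_congr (e1 t)
  have i2 : ∀ t, D.indicator (1 : (ι → ℝ) → ℝ≥0∞)
      (Function.update x i t) = A.indicator 1 t := fun t => rfl
  simp only [i1, i2]
  rw [lintegral_indicator_one (hAcompact.add isCompact_Icc).measurableSet,
    lintegral_add_left (measurable_one.indicator hAclosed.measurableSet),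
    lintegral_indicator_one hAclosed.measurableSet]
  rcases A.eq_empty_or_nonempty with hAe | hAne
  · have i3 : ∀ t, ((fun y => Function.update y i 0) '' D +
        segment ℝ (0 : ι → ℝ) (Pi.single i 1)).indicator (1 : (ι → ℝ) → ℝ≥0∞)
        (Function.update x i t) = (∅ : Set ℝ).indicator 1 t :=
      fun t => indicator_one_congr (by rw [e2, hAe]; simp)
    simp only [i3]
    simp [hAe]
  · have i3 : ∀ t, ((fun y => Function.update y i 0) '' D +
        segment ℝ (0 : ι → ℝ) (Pi.single i 1)).indicator (1 : (ι → ℝ) → ℝ≥0∞)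
        (Function.update x i t) = (Icc (0 : ℝ) 1).indicator 1 t :=
      fun t => indicator_one_congr (by rw [e2, and_iff_right hAne])
    simp only [i3]
    rw [lintegral_indicator_one measurableSet_Icc]
    obtain hI := eq_Icc_of_connected_compact ⟨hAne, hAconv.isPreconnected⟩ hAcompact
    have hle : sInf A ≤ sSup A := Real.sInf_le_sSup A hAcompact.bddBelow hAcompact.bddAbove
    rw [hI, Icc_add_Icc hle zero_le_one, Real.volume_Icc, Real.volume_Icc, Real.volume_Icc,
      ← ENNReal.ofReal_add (by linarith) (by norm_num)]
    congr 1
    ring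

end Segment

/-! ### Expansion of the volume of a convex body plus a parallelepiped. -/

section Erase

variable {E : Type*} [NormedAddCommGroup E] [InnerProductSpace ℝ E] {ι : Type*}

theorem image_segment_zero {F : Type*} [AddCommGroup F] [Module ℝ F] (f : E →ₗ[ℝ] F) (x : E) :
    f '' segment ℝ 0 x = segment ℝ 0 (f x) := by
  have := image_segment ℝ f.toAffineMap 0 x
  simpa using this

theorem image_sum_segment {F : Type*} [AddCommGroup F] [Module ℝ F] (f : E →ₗ[ℝ] F)
    (J : Finset ι) (v : ι → E) :
    f '' (∑ j ∈ J, segment ℝ 0 (v j)) = ∑ j ∈ J, segment ℝ 0 (f (v j)) := by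
  rw [Set.image_finsetSum]
  simp only [image_segment_zero]

theorem isCompact_segment_zero (x : E) : IsCompact (segment ℝ 0 x) := by
  rw [segment_eq_image]
  exact isCompact_Icc.image (by fun_prop)

theorem isCompact_sum_segment (J : Finset ι) (v : ι → E) :
    IsCompact (∑ j ∈ J, segment ℝ 0 (v j)) := by
  classical
  induction J using Finset.induction_on with
  | empty => simp
  | insert i J hi ih => rw [Finset.sum_insert hi]; exact (isCompact_segment_zero _).add ih

theorem convex_sum_segment (J : Finset ι) (v : ι → E) :
    Convex ℝ (∑ j ∈ J, segment ℝ 0 (v j)) := by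
  classical
  induction J using Finset.induction_on with
  | empty => simpa [Set.singleton_zero] using! convex_singleton (𝕜 := ℝ) (0 : E)
  | insert i J hi ih => rw [Finset.sum_insert hi]; exact (convex_segment _ _).add ih

/-- Uniqueness of Haar measure. It transfers volume identities to coordinate space, where the
unknown factor `c` is harmless because the identities are linear in the measure. -/
theorem exists_measure_eq_smul_volume_equivFun [FiniteDimensional ℝ E] [Fintype ι]
    [MeasurableSpace E] [BorelSpace E] (μ : Measure E) [μ.IsAddHaarMeasure] (b : Basis ι ℝ E) :
    ∃ c : ℝ≥0∞, ∀ S : Set E, μ S = c * volume (b.equivFun '' S) := by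
  let e : E ≃L[ℝ] (ι → ℝ) := b.equivFun.toContinuousLinearEquiv
  have : (μ.map e).IsAddHaarMeasure := e.isAddHaarMeasure_map μ
  refine ⟨((μ.map e).addHaarScalarFactor (volume : Measure (ι → ℝ)) : ℝ≥0∞), fun S => ?_⟩
  · have h := congrArg (fun ν : Measure (ι → ℝ) => ν (e '' S))
      (Measure.isAddLeftInvariant_eq_smul (μ.map e) (volume : Measure (ι → ℝ)))
    have h2 : μ.map e (e '' S) = μ S := by
      rw [show μ.map e = μ.map e.toHomeomorph.toMeasurableEquiv from rfl,
        MeasurableEquiv.map_apply]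
      congr 1
      exact e.injective.preimage_image S
    rw [h2] at h
    exact h

variable [DecidableEq ι]

/-- The linear map killing the basis vectors `b j`, `j ∈ J`, and fixing the other ones. -/
noncomputable def eraseCoords (b : Basis ι ℝ E) (J : Finset ι) : E →ₗ[ℝ] E :=
  b.constr ℝ fun j => if j ∈ J then 0 else b j

theorem eraseCoords_basis (b : Basis ι ℝ E) (J : Finset ι) (j : ι) :
    eraseCoords b J (b j) = if j ∈ J then 0 else b j :=
  b.constr_basis ℝ _ j

theorem eraseCoords_empty (b : Basis ι ℝ E) : eraseCoords b ∅ = LinearMap.id :=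
  b.ext fun j => by simp [eraseCoords_basis]

theorem eraseCoords_comp_singleton (b : Basis ι ℝ E) (J : Finset ι) (i : ι) :
    eraseCoords b J ∘ₗ eraseCoords b {i} = eraseCoords b (insert i J) :=
  b.ext fun j => by
    by_cases h : j = i
    · simp [eraseCoords_basis, h]
    · simp [eraseCoords_basis, h]


variable [FiniteDimensional ℝ E] [Fintype ι] [MeasurableSpace E] [BorelSpace E]
  (μ : Measure E) [μ.IsAddHaarMeasure]

/-- The volume of the sum of a compact convex set and a segment. -/
theorem measure_add_segment (b : Basis ι ℝ E) {D : Set E} (hD : IsCompact D)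
    (hconv : Convex ℝ D) (i : ι) :
    μ (D + segment ℝ 0 (b i)) =
      μ D + μ (eraseCoords b {i} '' D + segment ℝ 0 (b i)) := by
  obtain ⟨c, hc⟩ := exists_measure_eq_smul_volume_equivFun μ b
  have hcont : Continuous b.equivFun := LinearMap.continuous_of_finiteDimensional
    (b.equivFun : E →ₗ[ℝ] (ι → ℝ))
  have hseg : b.equivFun '' segment ℝ 0 (b i) = segment ℝ 0 (Pi.single i 1) := by
    have := image_segment_zero (b.equivFun : E →ₗ[ℝ] (ι → ℝ)) (b i)
    rw [LinearEquiv.coe_coe] at this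
    rw [this]
    congr 1
    ext j
    simp [Pi.single_apply, eq_comm]
  have hadd : ∀ S T : Set E, b.equivFun '' (S + T) = b.equivFun '' S + b.equivFun '' T :=
    fun S T => Set.image_add b.equivFun
  have herase : b.equivFun '' (eraseCoords b {i} '' D) =
      (fun y => Function.update y i 0) '' (b.equivFun '' D) := by
    rw [image_image, image_image]
    refine image_congr fun x _ => ?_
    have : (b.equivFun : E →ₗ[ℝ] (ι → ℝ)) ∘ₗ eraseCoords b {i} =
        (LinearMap.pi fun j => if j = i then 0 else LinearMap.proj j) ∘ₗ
          (b.equivFun : E →ₗ[ℝ] (ι → ℝ)) := by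
      refine b.ext fun k => ?_
      ext j
      by_cases hk : k = i <;> by_cases hj : j = i <;>
        simp [eraseCoords_basis, hk, hj, Finsupp.single_apply]
    have h := LinearMap.congr_fun this x
    simp only [LinearMap.comp_apply, LinearEquiv.coe_coe] at h
    rw [h]
    ext j
    by_cases hj : j = i
    · subst hj; simp
    · simp [hj]
  rw [hc, hc, hc, hadd, hadd, hseg, herase,
    volume_add_segment_single (hD.image hcont) (hconv.linear_image (b.equivFun : E →ₗ[ℝ] (ι → ℝ))),
    mul_add]

/-- The volume of the sum of a compact convex set and a parallelepiped. -/
theorem measure_add_sum_segment (b : Basis ι ℝ E) {C : Set E} (hC : IsCompact C)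
    (hconv : Convex ℝ C) (I : Finset ι) :
    μ (C + ∑ j ∈ I, segment ℝ 0 (b j)) =
      ∑ J ∈ I.powerset, μ (eraseCoords b J '' C + ∑ j ∈ J, segment ℝ 0 (b j)) := by
  -- The induction hypothesis is used twice: with `C` for the subsets avoiding `i`, and with the
  -- shadow of `C` plus `[0, b i]` for those containing `i`.
  induction I using Finset.induction_on generalizing C with
  | empty => simp [eraseCoords_empty]
  | insert i I hi ih =>
    have hfix : eraseCoords b {i} '' (∑ j ∈ I, segment ℝ 0 (b j)) =
        ∑ j ∈ I, segment ℝ 0 (b j) := by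
      rw [image_sum_segment]
      refine Finset.sum_congr rfl fun j hj => ?_
      rw [eraseCoords_basis, if_neg]
      rintro h
      exact hi (Finset.mem_singleton.1 h ▸ hj)
    have hcont : Continuous (eraseCoords b {i}) := LinearMap.continuous_of_finiteDimensional _
    rw [Finset.sum_insert hi, add_comm (segment ℝ 0 (b i)), ← add_assoc,
      measure_add_segment μ b (hC.add (isCompact_sum_segment _ _))
        (hconv.add (convex_sum_segment _ _)), Finset.sum_powerset_insert hi, ih hC hconv,
      Set.image_add, hfix, add_assoc, add_comm _ (segment ℝ 0 (b i)), ← add_assoc,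
      ih ((hC.image hcont).add (isCompact_segment_zero _))
        ((hconv.linear_image _).add (convex_segment _ _))]
    congr 1
    refine Finset.sum_congr rfl fun J hJ => ?_
    have hiJ : i ∉ J := fun h => hi (Finset.mem_powerset.1 hJ h)
    rw [Set.image_add, ← image_comp, ← LinearMap.coe_comp, eraseCoords_comp_singleton,
      image_segment_zero, eraseCoords_basis, if_neg hiJ, Finset.sum_insert hiJ, add_assoc]

end Erase

/-! ### From oblique to orthogonal projections. -/

section Orthogonal

variable {n : ℕ}

/-- The volume of a sum of sets in orthogonal subspaces. -/
theorem volume_add_of_orthogonal (L : Submodule ℝ (EuclideanSpace ℝ (Fin n)))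
    {S T : Set (EuclideanSpace ℝ (Fin n))} (hS : S ⊆ Lᗮ) (hT : T ⊆ L) :
    volume (S + T) = volIn Lᗮ S * volIn L T := by
  have hmp : MeasurePreserving (L.measurableEquivProd (0 : EuclideanSpace ℝ (Fin n)))
      volume volume := by
    have h : MeasurePreserving (fun x : EuclideanSpace ℝ (Fin n) => x -ᵥ (0 : EuclideanSpace ℝ (Fin n)))
      volume volume := by simpa using! MeasurePreserving.id _
    exact (WithLp.volume_preserving_ofLp _ _).comp
      (L.orthogonalDecomposition.measurePreserving.comp h)
  have hpre : L.measurableEquivProd (0 : EuclideanSpace ℝ (Fin n)) ⁻¹'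
      (((↑) ⁻¹' T : Set L) ×ˢ ((↑) ⁻¹' S : Set Lᗮ)) = S + T := by
    ext x
    rw [← MeasurableEquiv.image_symm]
    simp only [mem_image, Submodule.measurableEquivProd_symm_apply, mem_prod, mem_preimage,
      Prod.exists, mem_add, vadd_eq_add, add_zero]
    constructor
    · rintro ⟨t, s, ⟨ht, hs⟩, rfl⟩
      exact ⟨s, hs, t, ht, add_comm _ _⟩
    · rintro ⟨s, hs, t, ht, rfl⟩
      exact ⟨⟨t, hT ht⟩, ⟨s, hS hs⟩, ⟨ht, hs⟩, add_comm _ _⟩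
  have h := hmp.measure_preimage_equiv (((↑) ⁻¹' T : Set L) ×ˢ ((↑) ⁻¹' S : Set Lᗮ))
  rw [hpre] at h
  rw [h, volIn, volIn, OrthonormalBasis.addHaar_eq_volume, OrthonormalBasis.addHaar_eq_volume,
    mul_comm]
  exact Measure.prod_prod _ _

/-- Sylvester's identity `det (1 - AB) = det (1 - BA)`. -/
theorem det_one_sub_comp_eq_one {E : Type*} [AddCommGroup E] [Module ℝ E] [FiniteDimensional ℝ E]
    (f g : E →ₗ[ℝ] E) (h : g ∘ₗ f = 0) : LinearMap.det (LinearMap.id - f ∘ₗ g) = 1 := by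
  have b := finBasis ℝ E
  rw [← LinearMap.det_toMatrix b, map_sub, LinearMap.toMatrix_id, LinearMap.toMatrix_comp b b b,
    Matrix.det_one_sub_mul_comm, ← LinearMap.toMatrix_comp b b b, h]
  simp

/-- Both projections of a point differ from it by an element of `L_J`, so the two Minkowski sums
differ by a shear along `L_J`; the orthogonal sum then has product volume. -/
theorem volIn_proj_mul_volIn {n : ℕ} (b : Basis (Fin n) ℝ (EuclideanSpace ℝ (Fin n)))
    (J : Finset (Fin n)) (K : Set (EuclideanSpace ℝ (Fin n))) :
    volIn (linHull b J)ᗮ (proj K (linHull b J)ᗮ) * volIn (linHull b J) (subParallelepiped b J) =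
      volume (eraseCoords b J '' K + ∑ j ∈ J, segment ℝ 0 (b j)) := by
  set L := linHull b J with hL
  have hbL : ∀ j ∈ J, b j ∈ L := fun j hj => Submodule.subset_span ⟨j, hj, rfl⟩
  have hker : ∀ x ∈ L, eraseCoords b J x = 0 := by
    intro x hx
    have : L ≤ LinearMap.ker (eraseCoords b J) := by
      rw [hL, linHull, Submodule.span_le]
      rintro _ ⟨j, hj, rfl⟩
      simp [eraseCoords_basis, Finset.mem_coe.1 hj]
    exact this hx
  have hsub : ∀ x, x - eraseCoords b J x ∈ L := by
    intro x
    have : (LinearMap.id - eraseCoords b J).range ≤ L := by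
      rw [← Submodule.map_top, ← b.span_eq, Submodule.map_span, Submodule.span_le]
      rintro _ ⟨_, ⟨j, rfl⟩, rfl⟩
      by_cases hj : j ∈ J
      · simpa [eraseCoords_basis, hj] using hbL j hj
      · simp [eraseCoords_basis, hj]
    exact this ⟨x, rfl⟩
  have hP : subParallelepiped b J ⊆ L := by
    rw [subParallelepiped]
    intro x hx
    rw [Set.mem_finsetSum] at hx
    obtain ⟨g, hg, rfl⟩ := hx
    refine Submodule.sum_mem _ fun j hj => ?_
    exact L.convex.segment_subset L.zero_mem (hbL j hj) (hg hj)
  have hproj : proj K Lᗮ ⊆ Lᗮ := by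
    rintro _ ⟨x, -, rfl⟩
    exact Submodule.starProjection_apply_mem _ _
  rw [← volume_add_of_orthogonal L hproj hP]
  let p : EuclideanSpace ℝ (Fin n) →ₗ[ℝ] EuclideanSpace ℝ (Fin n) := L.starProjection.toLinearMap
  have hpL : ∀ x, p x ∈ L := fun x => Submodule.starProjection_apply_mem _ _
  have hpid : ∀ x ∈ L, p x = x := fun x hx => Submodule.starProjection_eq_self_iff.2 hx
  have hdet := det_one_sub_comp_eq_one p (eraseCoords b J)
    (LinearMap.ext fun x => hker _ (hpL x))
  -- With `e = eraseCoords b J`, the map `1 - p ∘ e` sends `e x` to `x - p x`, because `p` fixes `x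
  -- - e x ∈ L`. It fixes `L` pointwise, since `e` vanishes there.
  have himg : proj K Lᗮ + subParallelepiped b J =
      ((LinearMap.id - p ∘ₗ eraseCoords b J :
        EuclideanSpace ℝ (Fin n) →ₗ[ℝ] EuclideanSpace ℝ (Fin n))) ''
      (eraseCoords b J '' K + ∑ j ∈ J, segment ℝ 0 (b j)) := by
    rw [Set.image_add, proj, image_image]
    congr 1
    · refine image_congr fun x _ => ?_
      have h1 : eraseCoords b J (eraseCoords b J x) = eraseCoords b J x := by
        have := hker _ (hsub x)
        rw [map_sub, sub_eq_zero] at this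
        exact this.symm
      have h2 := hpid _ (hsub x)
      rw [map_sub] at h2
      rw [LinearMap.sub_apply, LinearMap.comp_apply, h1, LinearMap.id_apply,
        Submodule.starProjection_orthogonal_val]
      change x - p x = _
      rw [sub_eq_sub_iff_add_eq_add] at h2 ⊢
      rw [← h2]; abel
    · have : EqOn (LinearMap.id - p ∘ₗ eraseCoords b J :
          EuclideanSpace ℝ (Fin n) →ₗ[ℝ] EuclideanSpace ℝ (Fin n)) id (subParallelepiped b J) := by
        intro x hx
        simp [hker x (hP hx)]
      exact (this.image_eq_self).symm
  rw [himg, Measure.addHaar_image_linearMap, hdet]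
  simp

/-- The sum in the generalised Davenport inequality is the volume of a Minkowski sum. -/
theorem sum_volIn_eq_volume {n : ℕ} (b : Basis (Fin n) ℝ (EuclideanSpace ℝ (Fin n)))
    {K : Set (EuclideanSpace ℝ (Fin n))} (hK : IsCompact K) (hconv : Convex ℝ K) :
    ∑ i ∈ Finset.range (n + 1), ∑ J ∈ Finset.powersetCard i (Finset.univ : Finset (Fin n)),
        volIn (linHull b J)ᗮ (proj K (linHull b J)ᗮ) *
          volIn (linHull b J) (subParallelepiped b J) =
      volume (K + ∑ j, segment ℝ 0 (b j)) := by
  have h := Finset.sum_powerset (Finset.univ : Finset (Fin n))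
    (fun J => volume (eraseCoords b J '' K + ∑ j ∈ J, segment ℝ 0 (b j)))
  rw [Finset.card_fin] at h
  simp only [volIn_proj_mul_volIn]
  rw [measure_add_sum_segment volume b hK hconv, h]

end Orthogonal

/-! ### Measurable fundamental domains inside a covering set. -/

section FundamentalDomain

variable {E : Type*} [AddCommGroup E] [MeasurableSpace E] [MeasurableAdd E]

/-- A set containing a representative of every class modulo a countable subgroup contains an exact
measurable fundamental domain, which can be chosen to contain a given set of inequivalent points. -/
theorem exists_measurable_fundamentalDomain_between {L : Submodule ℤ E} [Countable L]
    {C P V : Set E} (hCm : MeasurableSet C) (hPm : MeasurableSet P) (hVm : MeasurableSet V)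
    (hC : ∀ x, ∃! g : L, g +ᵥ x ∈ C) (hP : ∀ x, ∃ g : L, g +ᵥ x ∈ P) (hVP : V ⊆ P)
    (hV : ∀ x ∈ V, ∀ g : L, g +ᵥ x ∈ V → g = 0) :
    ∃ F, MeasurableSet F ∧ V ⊆ F ∧ F ⊆ P ∧ ∀ x, ∃! g : L, g +ᵥ x ∈ F := by
  obtain ⟨ν, hν⟩ := exists_injective_nat L
  -- In each orbit missing `V`, label a point by the lattice vector leading to it from the orbit's
  -- unique point in `C`; `G` keeps the point of `P` whose label has the smallest number under `ν`.
  let G : Set E := {x | x ∈ P ∧ (∀ h : L, (h : E) + x ∉ V) ∧ ∃ g : L, (g : E) + x ∈ C ∧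
    ∀ h : L, (h : E) + x ∈ P → ν (-g) ≤ ν (h - g)}
  have hG : MeasurableSet G := by
    have hadd : ∀ (S : Set E), MeasurableSet S → ∀ h : L, Measurable fun x => (h : E) + x ∈ S :=
      fun S hS h => (measurable_mem.2 hS).comp (measurable_const_add (h : E))
    refine measurableSet_setOfPred.2 ((measurable_mem.2 hPm).and
      ((Measurable.forall fun h => (hadd V hVm h).not).and
      (Measurable.exists fun g => (hadd C hCm g).and (Measurable.forall fun h =>
        (hadd P hPm h).imp measurable_const))))
  have hunique : ∀ x ∈ V ∪ G, ∀ g : L, g +ᵥ x ∈ V ∪ G → g = 0 := by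
    rintro x (hx | hx) g (hg | hg)
    · exact hV x hx g hg
    · refine absurd hx ?_
      have := hg.2.1 (-g)
      simpa [Submodule.vadd_def] using this
    · exact absurd hg (hx.2.1 g)
    · obtain ⟨hxP, -, g1, hg1, h1⟩ := hx
      obtain ⟨hgP, -, g2, hg2, h2⟩ := hg
      have e : g1 = g2 + g := by
        refine (hC x).unique hg1 ?_
        rw [add_vadd]
        exact hg2
      have le1 := h1 g hgP
      have le2 := h2 (-g) (by simpa [Submodule.vadd_def] using hxP)
      have e1 : g - g1 = - g2 := by rw [e]; abel
      have e2 : -g - g2 = - g1 := by rw [e]; abel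
      rw [e1] at le1
      rw [e2] at le2
      have := hν (le_antisymm le1 le2)
      rw [neg_inj, e] at this
      simpa using this
  refine ⟨V ∪ G, hVm.union hG, subset_union_left, union_subset hVP fun x hx => hx.1, fun x => ?_⟩
  refine existsUnique_of_exists_of_unique ?_ ?_
  · by_cases hx : ∃ h : L, h +ᵥ x ∈ V
    · exact hx.imp fun h hh => Or.inl hh
    · push Not at hx
      obtain ⟨c, hc, -⟩ := hC x
      have hne : {k | ∃ h : L, h +ᵥ x ∈ P ∧ ν (h - c) = k}.Nonempty :=
        (hP x).elim fun h hh => ⟨_, h, hh, rfl⟩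
      obtain ⟨h, hhP, hh⟩ := Nat.sInf_mem hne
      refine ⟨h, Or.inr ⟨hhP, fun g => ?_, c - h, ?_, fun g hg => ?_⟩⟩
      · have := hx (g + h)
        rwa [add_vadd] at this
      · have : ((c - h : L) : E) + (h +ᵥ x) = c +ᵥ x := by
          simp only [Submodule.vadd_def, vadd_eq_add, Submodule.coe_sub]
          abel
        rwa [this]
      · rw [neg_sub, hh]
        refine Nat.sInf_le ⟨g + h, ?_, ?_⟩
        · rw [add_vadd]; exact hg
        · congr 1; abel
  · intro g h hg hh
    have := hunique _ hg (h - g) (by rwa [← add_vadd, sub_add_cancel])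
    exact (sub_eq_zero.1 this).symm

end FundamentalDomain

/-! ### Packing `K + P`, and what equality forces. -/

section Counting

variable {n : ℕ}

theorem intLattice_eq_span_toBasis :
    intLattice n = Submodule.span ℤ (range (EuclideanSpace.basisFun (Fin n) ℝ).toBasis) := by
  rw [OrthonormalBasis.coe_toBasis, intLattice]

instance : DiscreteTopology (intLattice n) := by
  rw [intLattice_eq_span_toBasis]
  infer_instance

instance : IsZLattice ℝ (intLattice n) where
  span_top := by
    rw [intLattice_eq_span_toBasis]
    exact ZSpan.span_top _

theorem finite_inter_intLattice {K : Set (EuclideanSpace ℝ (Fin n))} (hK : IsCompact K) :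
    (K ∩ intLattice n).Finite := by
  rw [intLattice_eq_span_toBasis]
  exact ZSpan.setFinite_inter _ hK.isBounded

theorem existsUnique_vadd_mem_unitCube (x : EuclideanSpace ℝ (Fin n)) :
    ∃! g : intLattice n, g +ᵥ x ∈
      ZSpan.fundamentalDomain (EuclideanSpace.basisFun (Fin n) ℝ).toBasis := by
  have := ZSpan.exist_unique_vadd_mem_fundamentalDomain
    (EuclideanSpace.basisFun (Fin n) ℝ).toBasis x
  rwa [← intLattice_eq_span_toBasis] at this

theorem volume_fundamentalDomain_eq_parallelepiped
    (b : Basis (Fin n) ℝ (EuclideanSpace ℝ (Fin n))) :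
    volume (ZSpan.fundamentalDomain b) = volume (∑ j, segment ℝ 0 (b j)) := by
  rw [← parallelepiped_eq_sum_segment]
  exact measure_congr (ZSpan.fundamentalDomain_ae_parallelepiped b volume)

theorem volume_unitCube :
    volume (ZSpan.fundamentalDomain (EuclideanSpace.basisFun (Fin n) ℝ).toBasis) = 1 := by
  rw [volume_fundamentalDomain_eq_parallelepiped, ← parallelepiped_eq_sum_segment,
    OrthonormalBasis.coe_toBasis]
  exact OrthonormalBasis.volume_parallelepiped _

instance : VAddInvariantMeasure (intLattice n) (EuclideanSpace ℝ (Fin n)) volume :=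
  ⟨fun c s _ => measure_preimage_add volume (c : EuclideanSpace ℝ (Fin n)) s⟩

theorem volume_eq_one_of_existsUnique {F : Set (EuclideanSpace ℝ (Fin n))}
    (hF : MeasurableSet F) (h : ∀ x, ∃! g : intLattice n, g +ᵥ x ∈ F) : volume F = 1 := by
  have h1 : IsAddFundamentalDomain (intLattice n) F := .mk' hF.nullMeasurableSet h
  have h2 : IsAddFundamentalDomain (intLattice n)
      (ZSpan.fundamentalDomain (EuclideanSpace.basisFun (Fin n) ℝ).toBasis) :=
    .mk' (ZSpan.fundamentalDomain_measurableSet _).nullMeasurableSet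
      existsUnique_vadd_mem_unitCube
  rw [← volume_unitCube (n := n)]
  exact h1.measure_eq h2

/-- Translates of a fundamental domain of `ℤⁿ` by the lattice points of `K` pack `K + P`. -/
theorem latticeCount_add_volume_le {K F P U : Set (EuclideanSpace ℝ (Fin n))}
    (hK : IsCompact K) (hF : MeasurableSet F) (h : ∀ x, ∃! g : intLattice n, g +ᵥ x ∈ F)
    (hFP : F ⊆ P) (hU : U ⊆ K + P) (hUm : MeasurableSet U)
    (hdisj : ∀ x ∈ K ∩ intLattice n, Disjoint U (x +ᵥ F)) :
    latticeCount K + volume U ≤ volume (K + P) := by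
  have hfin := finite_inter_intLattice hK
  have hcount : latticeCount K = (hfin.toFinset.card : ℝ≥0∞) := by
    rw [latticeCount, hfin.encard_eq_coe_toFinset_card]
    rfl
  have hsum : volume (⋃ x ∈ hfin.toFinset, x +ᵥ F) = (hfin.toFinset.card : ℝ≥0∞) := by
    rw [measure_biUnion_finset]
    · simp [measure_vadd, volume_eq_one_of_existsUnique hF h]
    · intro x hx y hy hxy
      rw [Function.onFun, Set.disjoint_left]
      intro p hpx hpy
      rw [Set.mem_vadd_set_iff_neg_vadd_mem] at hpx hpy
      simp only [Finite.coe_toFinset] at hx hy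
      have := (h p).unique (y₁ := ⟨-x, neg_mem hx.2⟩) (y₂ := ⟨-y, neg_mem hy.2⟩) hpx hpy
      exact hxy (neg_injective (congrArg Subtype.val this))
    · intro x _
      exact hF.const_vadd x
  have hUd : Disjoint (⋃ x ∈ hfin.toFinset, x +ᵥ F) U := by
    rw [Set.disjoint_iUnion₂_left]
    intro x hx
    exact (hdisj x (by simpa using hx)).symm
  rw [hcount, ← hsum, ← measure_union hUd hUm]
  refine measure_mono (union_subset (iUnion₂_subset fun x hx => ?_) hU)
  rintro _ ⟨f, hf, rfl⟩
  exact add_mem_add ((hfin.mem_toFinset.1 hx).1) (hFP hf)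

variable (b : Basis (Fin n) ℝ (EuclideanSpace ℝ (Fin n)))

theorem span_le_intLattice (hb : ∀ j, b j ∈ intLattice n) : Submodule.span ℤ (range b) ≤ intLattice n := by
  rw [Submodule.span_le]
  rintro _ ⟨j, rfl⟩
  exact hb j

theorem exists_vadd_mem_fundamentalDomain (hb : ∀ j, b j ∈ intLattice n)
    (x : EuclideanSpace ℝ (Fin n)) :
    ∃ g : intLattice n, g +ᵥ x ∈ ZSpan.fundamentalDomain b := by
  obtain ⟨g, hg, -⟩ := ZSpan.exist_unique_vadd_mem_fundamentalDomain b x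
  exact ⟨⟨g, span_le_intLattice b hb g.2⟩, hg⟩

theorem fundamentalDomain_subset_sum_segment :
    ZSpan.fundamentalDomain b ⊆ ∑ j, segment ℝ 0 (b j) := by
  rw [← parallelepiped_eq_sum_segment]
  exact ZSpan.fundamentalDomain_subset_parallelepiped b

theorem latticeCount_le_volume (hb : ∀ j, b j ∈ intLattice n)
    {K : Set (EuclideanSpace ℝ (Fin n))} (hK : IsCompact K) :
    latticeCount K ≤ volume (K + ∑ j, segment ℝ 0 (b j)) := by
  obtain ⟨F, hFm, -, hFP, hF⟩ := exists_measurable_fundamentalDomain_between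
    (ZSpan.fundamentalDomain_measurableSet _) (ZSpan.fundamentalDomain_measurableSet b)
    MeasurableSet.empty existsUnique_vadd_mem_unitCube
    (exists_vadd_mem_fundamentalDomain b hb) (empty_subset _) (by simp)
  have := latticeCount_add_volume_le hK hFm hF
    (hFP.trans (fundamentalDomain_subset_sum_segment b)) (empty_subset _)
    MeasurableSet.empty (by simp)
  simpa using this

/-- If `x ∉ K`, choose `F` to contain a small open `V` with `x + V ⊆ k + P`. Then `x + V` lies in `K
+ P` with positive volume and avoids the whole packing, contradicting equality. -/
theorem mem_of_latticeCount_eq (hb : ∀ j, b j ∈ intLattice n)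
    {K : Set (EuclideanSpace ℝ (Fin n))} (hK : IsCompact K)
    (heq : latticeCount K = volume (K + ∑ j, segment ℝ 0 (b j)))
    {k x : EuclideanSpace ℝ (Fin n)} (hk : k ∈ K) (hx : x ∈ intLattice n)
    (hkx : ∀ i, |b.repr k i - b.repr x i| < 1) : x ∈ K := by
  by_contra hxK
  -- With `δ = k - x` in coordinates, `u` and `u + (x - k)` have coordinates `(1 + δ i) / 2` and `(1
  -- - δ i) / 2`, both in `(0, 1)` since `|δ i| < 1`.
  let u : EuclideanSpace ℝ (Fin n) := b.equivFun.symm fun i =>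
    (1 + (b.repr k i - b.repr x i)) / 2
  have hu : ∀ i, b.repr u i = (1 + (b.repr k i - b.repr x i)) / 2 := fun i => by
    rw [← b.equivFun_apply, LinearEquiv.apply_symm_apply]
  let O : Set (EuclideanSpace ℝ (Fin n)) := {y | ∀ i, b.repr y i ∈ Ioo (0 : ℝ) 1}
  have hcont : Continuous b.equivFun := LinearMap.continuous_of_finiteDimensional
    (b.equivFun : EuclideanSpace ℝ (Fin n) →ₗ[ℝ] (Fin n → ℝ))
  have hO : IsOpen O := by
    have : O = b.equivFun ⁻¹' (Set.pi univ fun _ => Ioo (0 : ℝ) 1) := by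
      ext y; simp [O]
    rw [this]
    exact (isOpen_set_pi finite_univ fun _ _ => isOpen_Ioo).preimage hcont
  have hOP : O ⊆ ZSpan.fundamentalDomain b := fun y hy i => Ioo_subset_Ico_self (hy i)
  -- Radius `1 / 2` keeps differences of points of `V` shorter than 1, so no two are congruent
  -- modulo `ℤⁿ`.
  let V := (O ∩ (fun y => y + (x - k)) ⁻¹' O) ∩ Metric.ball u (1 / 2)
  have hVo : IsOpen V := (hO.inter (hO.preimage (by fun_prop))).inter Metric.isOpen_ball
  have hVne : V.Nonempty := by
    refine ⟨u, ⟨fun i => ?_, fun i => ?_⟩, by simp⟩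
    · have := abs_lt.1 (hkx i)
      rw [hu]; constructor <;> linarith
    · have := abs_lt.1 (hkx i)
      rw [map_add, map_sub, Finsupp.add_apply, Finsupp.sub_apply, hu]; constructor <;> linarith
  have hV : ∀ y ∈ V, ∀ g : intLattice n, g +ᵥ y ∈ V → g = 0 := by
    intro y hy g hg
    have h1 : ‖(g : EuclideanSpace ℝ (Fin n))‖ < 1 := by
      have := dist_triangle_right (g +ᵥ y) y u
      have h2 := Metric.mem_ball.1 hy.2
      have h3 := Metric.mem_ball.1 hg.2
      rw [Submodule.vadd_def, vadd_eq_add, dist_eq_norm, add_sub_cancel_right] at this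
      rw [Submodule.vadd_def, vadd_eq_add] at h3
      linarith
    ext i
    obtain ⟨m, hm⟩ := (mem_intLattice_iff _).1 g.2 i
    have h2 := (PiLp.norm_apply_le (g : EuclideanSpace ℝ (Fin n)) i).trans_lt h1
    rw [hm, Real.norm_eq_abs, ← Int.cast_abs] at h2
    have : m = 0 := Int.abs_lt_one_iff.1 (by exact_mod_cast h2)
    rw [hm, this]
    simp
  obtain ⟨F, hFm, hVF, hFP, hF⟩ := exists_measurable_fundamentalDomain_between
    (ZSpan.fundamentalDomain_measurableSet _) (ZSpan.fundamentalDomain_measurableSet b)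
    hVo.measurableSet existsUnique_vadd_mem_unitCube
    (exists_vadd_mem_fundamentalDomain b hb) (fun y hy => hOP hy.1.1) hV
  have hle := latticeCount_add_volume_le (U := x +ᵥ V) hK hFm hF
    (hFP.trans (fundamentalDomain_subset_sum_segment b)) ?_
    (hVo.measurableSet.const_vadd x) ?_
  · rw [← heq, measure_vadd] at hle
    have hfin : latticeCount K ≠ ∞ := by
      rw [latticeCount, (finite_inter_intLattice hK).encard_eq_coe_toFinset_card]
      simp
    have := ENNReal.lt_add_right hfin (hVo.measure_pos volume hVne).ne'
    exact absurd hle this.not_ge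
  · rintro _ ⟨v, hv, rfl⟩
    refine ⟨k, hk, v + (x - k), fundamentalDomain_subset_sum_segment b (hOP hv.1.2), ?_⟩
    simp only [vadd_eq_add]
    abel
  · intro y hy
    rw [Set.disjoint_left]
    intro p hpx hpy
    rw [Set.mem_vadd_set_iff_neg_vadd_mem] at hpx hpy
    have := (hF p).unique (y₁ := ⟨-x, neg_mem hx⟩) (y₂ := ⟨-y, neg_mem hy.2⟩) (hVF hpx) hpy
    exact hxK (neg_injective (congrArg Subtype.val this) ▸ hy.1)

end Counting

/-! ### Convex sets closed under nearby lattice points are boxes. -/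

section Box

variable {ι : Type*} [Fintype ι] [DecidableEq ι]

theorem Icc_subset_of_corners {C : Set (ι → ℝ)} (hC : Convex ℝ C) {lo hi : ι → ℝ}
    (h : ∀ c : ι → ℝ, (∀ i, c i = lo i ∨ c i = hi i) → c ∈ C) : Icc lo hi ⊆ C := by
  -- `J` holds the coordinates not yet required to be extreme; each new one is handled by convexity
  -- on a segment parallel to its axis.
  have key : ∀ J : Finset ι, ∀ y ∈ Icc lo hi, (∀ i ∉ J, y i = lo i ∨ y i = hi i) → y ∈ C := by
    intro J
    induction J using Finset.induction_on with
    | empty => exact fun y _ hy => h y fun i => hy i (Finset.notMem_empty i)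
    | insert i J hi' ih =>
      intro y hy hyJ
      have hle : lo i ≤ hi i := (hy.1 i).trans (hy.2 i)
      have hseg : y i ∈ segment ℝ (lo i) (hi i) := by
        rw [segment_eq_Icc hle]; exact ⟨hy.1 i, hy.2 i⟩
      obtain ⟨p, q, hp, hq, hpq, hy'⟩ := hseg
      have hmem : ∀ c, lo i ≤ c → c ≤ hi i → (c = lo i ∨ c = hi i) →
          Function.update y i c ∈ C := by
        intro c h1 h2 h3
        refine ih _ ⟨fun j => ?_, fun j => ?_⟩ fun j hj => ?_
        · by_cases hji : j = i
          · subst hji; simpa using h1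
          · simpa [hji] using hy.1 j
        · by_cases hji : j = i
          · subst hji; simpa using h2
          · simpa [hji] using hy.2 j
        · by_cases hji : j = i
          · subst hji; simpa using h3
          · simpa [hji] using hyJ j (by simp [hji, hj])
      have := hC (hmem (lo i) le_rfl hle (Or.inl rfl)) (hmem (hi i) hle le_rfl (Or.inr rfl))
        hp hq hpq
      convert this using 1
      ext j
      by_cases hji : j = i
      · subst hji; simpa using hy'.symm
      · simp only [Pi.add_apply, Pi.smul_apply, Function.update_of_ne hji, smul_eq_mul]
        rw [← add_mul, hpq, one_mul]
  exact fun y hy => key Finset.univ y hy fun i hi => absurd (Finset.mem_univ i) hi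

variable {C : Set (ι → ℝ)} {M : AddSubgroup (ι → ℝ)}

/-- `C` contains every point of `M` whose unit cube meets a unit cube based in `C`. -/
def ContainsNearby (C : Set (ι → ℝ)) (M : AddSubgroup (ι → ℝ)) : Prop :=
  ∀ k ∈ C, ∀ x ∈ M, (∀ i, |k i - x i| < 1) → x ∈ C

/-- Move from `x` towards `y` by a fraction small enough that every coordinate changes by less than
1. The `i`-th moves strictly in direction `σ`, so `x + σ e_i` is near the resulting point. -/
theorem ContainsNearby.step (h : ContainsNearby C M) (hC : Convex ℝ C)
    (hM : ∀ i, Pi.single i 1 ∈ M) {x y : ι → ℝ} (hxM : x ∈ M) (hx : x ∈ C) (hy : y ∈ C) {i : ι}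
    {σ : ℤ} (hσ : σ = 1 ∨ σ = -1) (hxy : 0 < σ * (y i - x i)) :
    x + σ • Pi.single i 1 ∈ C := by
  set m : ℝ := ∑ j, |y j - x j| with hm
  have hm0 : 0 ≤ m := Finset.sum_nonneg fun j _ => abs_nonneg _
  have hle : ∀ j, |y j - x j| ≤ m := fun j =>
    Finset.single_le_sum (f := fun j => |y j - x j|) (fun j _ => abs_nonneg _) (Finset.mem_univ j)
  have hpos : 0 < 1 / (1 + m) := by positivity
  have hε : ∀ j, |1 / (1 + m) * (y j - x j)| < 1 := by
    intro j
    rw [abs_mul, abs_of_pos hpos, one_div_mul_eq_div, div_lt_one (by linarith)]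
    linarith [hle j]
  have hk : x + (1 / (1 + m)) • (y - x) ∈ C :=
    hC.add_smul_sub_mem hx hy ⟨hpos.le, by rw [div_le_one (by linarith)]; linarith⟩
  refine h _ hk _ (M.add_mem hxM (M.zsmul_mem (hM i) σ)) fun j => ?_
  have hj := hε j
  by_cases hji : j = i
  · subst hji
    have hmul := mul_pos hpos hxy
    rw [abs_lt] at hj
    have e : (x + (1 / (1 + m)) • (y - x)) j - (x + σ • Pi.single j (1 : ℝ) : ι → ℝ) j =
        1 / (1 + m) * (y j - x j) - σ := by
      simp
    rw [e, abs_lt]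
    rcases hσ with rfl | rfl
    · push_cast at hmul ⊢
      constructor <;> linarith
    · push_cast at hmul ⊢
      constructor <;> linarith
  · have e : (x + (1 / (1 + m)) • (y - x)) j - (x + σ • Pi.single i (1 : ℝ) : ι → ℝ) j =
        1 / (1 + m) * (y j - x j) := by
      simp [hji]
    rwa [e]

/-- As long as the extreme value `y i` is not hit, another unit step is possible; never hitting it
would contradict the bound `hext`. -/
theorem ContainsNearby.slide (h : ContainsNearby C M) (hC : Convex ℝ C)
    (hM : ∀ i, Pi.single i 1 ∈ M) {x y : ι → ℝ} (hxM : x ∈ M) (hx : x ∈ C) (hy : y ∈ C) {i : ι}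
    {σ : ℤ} (hσ : σ = 1 ∨ σ = -1) (hext : ∀ k ∈ C, 0 ≤ σ * (y i - k i)) :
    ∃ m : ℤ, x + m • Pi.single i 1 ∈ C ∧ x i + m = y i := by
  by_contra! hne
  have hall : ∀ m : ℕ, x + (m * σ : ℤ) • Pi.single i 1 ∈ C := by
    intro m
    induction m with
    | zero => simpa using hx
    | succ m ih =>
      have hxm := hne _ ih
      have hstep := h.step (i := i) (y := y) (σ := σ) hC hM
        (M.add_mem hxM (M.zsmul_mem (hM i) (m * σ))) ih hy hσ ?_
      · rw [add_assoc, ← add_smul] at hstep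
        convert hstep using 3
        push_cast; ring
      · refine lt_of_le_of_ne (hext _ ih) fun h0 => hxm ?_
        have hσ0 : (σ : ℝ) ≠ 0 := by rcases hσ with rfl | rfl <;> norm_num
        have := (mul_eq_zero.1 h0.symm).resolve_left hσ0
        simp at this
        push_cast
        linarith
  obtain ⟨m, hm⟩ := exists_nat_gt (σ * (y i - x i) : ℝ)
  have := hext _ (hall m)
  have hσσ : (σ : ℝ) * σ = 1 := by rcases hσ with rfl | rfl <;> norm_num
  simp at this
  nlinarith

/-- A compact convex set containing all nearby points of `M` is a box, with all corners in every
class of `M` modulo `ℤ^ι`. -/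
theorem ContainsNearby.exists_eq_Icc (h : ContainsNearby C M) (hC : Convex ℝ C)
    (hM : ∀ i, Pi.single i 1 ∈ M) (hcomp : IsCompact C) (hne : C.Nonempty) :
    (∀ x ∈ M, ∀ i, ∃ m : ℤ, x i = m) ∧
      ∃ lo hi : ι → ℤ, C = Icc (fun i => (lo i : ℝ)) (fun i => (hi i : ℝ)) := by
  have hmin := fun i : ι => hcomp.exists_isMinOn hne (continuous_apply i).continuousOn
  have hmax := fun i : ι => hcomp.exists_isMaxOn hne (continuous_apply i).continuousOn
  choose p hp hpmin using hmin
  choose q hq hqmax using hmax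
  have corner : ∀ x ∈ M, x ∈ C → ∀ c : ι → ℝ, (∀ i, c i = p i i ∨ c i = q i i) →
      c ∈ C ∧ ∀ i, ∃ m : ℤ, x i + m = c i := by
    intro x hxM hx c hc
    have hslide : ∀ i, ∀ y ∈ M, y ∈ C → ∃ m : ℤ, y + m • Pi.single i 1 ∈ C ∧ y i + m = c i := by
      intro i y hyM hy
      rcases hc i with hci | hci <;> rw [hci]
      · exact h.slide hC hM hyM hy (hp i) (Or.inr rfl) fun k hk => by
          have : p i i ≤ k i := hpmin i hk
          push_cast; linarith
      · exact h.slide hC hM hyM hy (hq i) (Or.inl rfl) fun k hk => by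
          have : k i ≤ q i i := hqmax i hk
          push_cast; linarith
    have key : ∀ J : Finset ι, ∃ y ∈ M, y ∈ C ∧ (∀ i, ∃ m : ℤ, x i + m = y i) ∧
        ∀ i ∈ J, y i = c i := by
      intro J
      induction J using Finset.induction_on with
      | empty => exact ⟨x, hxM, hx, fun i => ⟨0, by simp⟩, by simp⟩
      | insert i J hi ih =>
        obtain ⟨y, hyM, hy, hxy, hyJ⟩ := ih
        obtain ⟨m, hm, hmc⟩ := hslide i y hyM hy
        refine ⟨_, M.add_mem hyM (M.zsmul_mem (hM i) m), hm, fun j => ?_, fun j hj => ?_⟩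
        · obtain ⟨l, hl⟩ := hxy j
          by_cases hji : j = i
          · subst hji
            exact ⟨l + m, by simp [← hl, add_assoc]⟩
          · exact ⟨l, by simp [hl, hji]⟩
        · by_cases hji : j = i
          · subst hji; simpa using hmc
          · simpa [hji] using hyJ j ((Finset.mem_insert.1 hj).resolve_left hji)
    obtain ⟨y, -, hy, hxy, hyc⟩ := key Finset.univ
    have : y = c := funext fun i => hyc i (Finset.mem_univ i)
    exact ⟨this ▸ hy, this ▸ hxy⟩
  -- Every class of `M` modulo `ℤ^ι` is represented in `C`: shift `x` by integers until it lies less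
  -- than 1 below `k` in each coordinate. All classes then reach the same corners, hence coincide
  -- with the class of 0.
  have near : ∀ x ∈ M, ∃ y ∈ M, y ∈ C ∧ ∀ i, ∃ m : ℤ, x i + m = y i := by
    intro x hx
    obtain ⟨k, hk⟩ := hne
    have hy : x + ∑ i, ⌊k i - x i⌋ • Pi.single i 1 ∈ M :=
      M.add_mem hx (M.sum_mem fun i _ => M.zsmul_mem (hM i) _)
    have hyi : ∀ i, (x + ∑ i, ⌊k i - x i⌋ • Pi.single i (1 : ℝ)) i = x i + ⌊k i - x i⌋ := by
      intro i
      simp [Finset.sum_apply, Pi.single_apply]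
    refine ⟨_, hy, h k hk _ hy fun i => ?_, fun i => ⟨_, (hyi i).symm⟩⟩
    rw [hyi, abs_lt]
    have h1 := Int.floor_le (k i - x i)
    have h2 := Int.lt_floor_add_one (k i - x i)
    constructor <;> linarith
  have corner' : ∀ x ∈ M, ∀ c : ι → ℝ, (∀ i, c i = p i i ∨ c i = q i i) →
      c ∈ C ∧ ∀ i, ∃ m : ℤ, x i + m = c i := by
    intro x hx c hc
    obtain ⟨y, hyM, hy, hxy⟩ := near x hx
    obtain ⟨hcC, hyc⟩ := corner y hyM hy c hc
    refine ⟨hcC, fun i => ?_⟩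
    obtain ⟨l, hl⟩ := hxy i
    obtain ⟨m, hm⟩ := hyc i
    exact ⟨l + m, by push_cast; rw [← hm, ← hl, add_assoc]⟩
  obtain ⟨-, hlo⟩ := corner' 0 M.zero_mem (fun i => p i i) fun i => Or.inl rfl
  obtain ⟨-, hhi⟩ := corner' 0 M.zero_mem (fun i => q i i) fun i => Or.inr rfl
  refine ⟨fun x hx i => ?_, ?_⟩
  · obtain ⟨m, hm⟩ := (corner' x hx (fun i => p i i) fun i => Or.inl rfl).2 i
    obtain ⟨l, hl⟩ := hlo i
    refine ⟨l - m, ?_⟩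
    rw [Pi.zero_apply] at hl
    push_cast
    linarith
  · choose lo hlo using hlo
    choose hi hhi using hhi
    simp only [Pi.zero_apply, zero_add] at hlo hhi
    refine ⟨lo, hi, ?_⟩
    simp only [hlo, hhi]
    refine Subset.antisymm (fun k hk => ⟨fun i => hpmin i hk, fun i => hqmax i hk⟩) ?_
    exact Icc_subset_of_corners hC fun c hc => (corner' 0 M.zero_mem c hc).1

end Box

/-! ### Characterisation of equality. -/

section Equality

variable {n : ℕ} (b : Basis (Fin n) ℝ (EuclideanSpace ℝ (Fin n)))

theorem continuous_equivFun : Continuous b.equivFun :=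
  LinearMap.continuous_of_finiteDimensional
    (b.equivFun : EuclideanSpace ℝ (Fin n) →ₗ[ℝ] (Fin n → ℝ))

/-- Boxes in the coordinates of `b` with integral bounds and nonempty interior. -/
def IsIntegralBox (K : Set (EuclideanSpace ℝ (Fin n))) : Prop :=
  ∃ lo hi : Fin n → ℤ, (∀ i, lo i < hi i) ∧
    K = {x | ∀ i, b.repr x i ∈ Icc (lo i : ℝ) (hi i : ℝ)}

variable {b}

theorem span_eq_and_isIntegralBox_of_latticeCount_eq (hb : ∀ j, b j ∈ intLattice n)
    {K : Set (EuclideanSpace ℝ (Fin n))} (hK : IsCompact K) (hconv : Convex ℝ K)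
    (hint : (interior K).Nonempty)
    (heq : latticeCount K = volume (K + ∑ j, segment ℝ 0 (b j))) :
    Submodule.span ℤ (range b) = intLattice n ∧ IsIntegralBox b K := by
  let M : AddSubgroup (Fin n → ℝ) :=
    (intLattice n).toAddSubgroup.map (b.equivFun : EuclideanSpace ℝ (Fin n) →+ (Fin n → ℝ))
  have hM : ∀ i, Pi.single i 1 ∈ M := by
    refine fun i => ⟨b i, hb i, ?_⟩
    ext j
    simp [Pi.single_apply, eq_comm]
  have hnear : ContainsNearby (b.equivFun '' K) M := by
    rintro _ ⟨k, hk, rfl⟩ _ ⟨x, hx, rfl⟩ hkx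
    exact ⟨x, mem_of_latticeCount_eq b hb hK heq hk hx hkx, rfl⟩
  obtain ⟨hZ, lo, hi, hbox⟩ := hnear.exists_eq_Icc
    (hconv.linear_image (b.equivFun : EuclideanSpace ℝ (Fin n) →ₗ[ℝ] (Fin n → ℝ))) hM
    (hK.image (continuous_equivFun b)) ((hint.mono interior_subset).image _)
  have hKbox : K = {x | ∀ i, b.repr x i ∈ Icc (lo i : ℝ) (hi i : ℝ)} := by
    ext x
    rw [← b.equivFun.injective.mem_set_image, hbox]
    simp [Pi.le_def, forall_and]
  refine ⟨le_antisymm (span_le_intLattice b hb) fun x hx => ?_, lo, hi, fun i => ?_, hKbox⟩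
  · rw [b.mem_span_iff_repr_mem ℤ]
    intro i
    obtain ⟨m, hm⟩ := hZ _ ⟨x, hx, rfl⟩ i
    exact ⟨m, by simpa using hm.symm⟩
  -- An interior point of `K` can be moved a little along `b i`, so the box has positive width in
  -- that direction.
  · obtain ⟨x, hx⟩ := hint
    have hcont : Continuous fun t : ℝ => x + t • b i := by fun_prop
    have hnhds : ∀ᶠ t in nhds (0 : ℝ), x + t • b i ∈ K :=
      hcont.continuousAt (mem_interior_iff_mem_nhds.1 (by simpa using hx))
    obtain ⟨ε, hε, hball⟩ := Metric.eventually_nhds_iff.1 hnhds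
    have h1 := hball (y := ε / 2) (by rw [dist_zero_right, Real.norm_of_nonneg] <;> linarith)
    have h2 := interior_subset hx
    rw [hKbox] at h1 h2
    have h3 := (h1 i).2
    have h4 := (h2 i).1
    simp at h3
    have : (lo i : ℝ) < hi i := by linarith
    exact_mod_cast this

theorem volume_parallelepiped_of_span_eq (hspan : Submodule.span ℤ (range b) = intLattice n) :
    volume (∑ j, segment ℝ 0 (b j)) = 1 := by
  rw [← volume_fundamentalDomain_eq_parallelepiped]
  refine volume_eq_one_of_existsUnique (ZSpan.fundamentalDomain_measurableSet b) fun x => ?_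
  have := ZSpan.exist_unique_vadd_mem_fundamentalDomain b x
  rwa [hspan] at this

theorem mem_sum_segment_iff (x : EuclideanSpace ℝ (Fin n)) :
    x ∈ ∑ j, segment ℝ 0 (b j) ↔ ∀ j, b.repr x j ∈ Icc (0 : ℝ) 1 := by
  rw [← parallelepiped_eq_sum_segment, parallelepiped_basis_eq]
  rfl

theorem volume_le_latticeCount (hspan : Submodule.span ℤ (range b) = intLattice n)
    {K : Set (EuclideanSpace ℝ (Fin n))} (hcomp : IsCompact K) (hK : IsIntegralBox b K) :
    volume (K + ∑ j, segment ℝ 0 (b j)) ≤ latticeCount K := by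
  have hfin := finite_inter_intLattice hcomp
  have hcount : latticeCount K = (hfin.toFinset.card : ℝ≥0∞) := by
    rw [latticeCount, hfin.encard_eq_coe_toFinset_card]
    rfl
  obtain ⟨lo, hi, hlt, hbox⟩ := hK
  have hcover : K + ∑ j, segment ℝ 0 (b j) ⊆
      ⋃ x ∈ hfin.toFinset, x +ᵥ ∑ j, segment ℝ 0 (b j) := by
    rintro _ ⟨k, hk, p, hp, rfl⟩
    rw [mem_sum_segment_iff] at hp
    rw [hbox] at hk
    -- Rounding down alone may leave `K` beyond its upper faces, so it is capped at `hi i`; as `k +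
    -- p` exceeds `hi i` by at most 1, it still lies in the closed cell at `x`.
    let m : Fin n → ℤ := fun i => min ⌊b.repr (k + p) i⌋ (hi i)
    let x : EuclideanSpace ℝ (Fin n) := b.equivFun.symm fun i => (m i : ℝ)
    have hx : ∀ i, b.repr x i = m i := fun i => by
      rw [← b.equivFun_apply, LinearEquiv.apply_symm_apply]
    have hsum : ∀ i, b.repr (k + p) i = b.repr k i + b.repr p i := fun i => by simp
    have hxL : x ∈ intLattice n := by
      rw [← hspan, b.mem_span_iff_repr_mem ℤ]
      exact fun i => ⟨m i, by simp [hx]⟩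
    have hxK : x ∈ K := by
      rw [hbox]
      intro i
      rw [hx]
      refine ⟨Int.cast_le.2 (le_min (Int.le_floor.2 ?_) (hlt i).le),
        Int.cast_le.2 (min_le_right _ _)⟩
      rw [hsum]
      linarith [(hk i).1, (hp i).1]
    refine mem_iUnion₂.2 ⟨x, hfin.mem_toFinset.2 ⟨hxK, hxL⟩, ?_⟩
    rw [Set.mem_vadd_set_iff_neg_vadd_mem, mem_sum_segment_iff]
    intro i
    have e : b.repr (-x +ᵥ (k + p)) i = b.repr (k + p) i - m i := by
      rw [vadd_eq_add, map_add, map_neg, Finsupp.add_apply, Finsupp.neg_apply, hx]; ring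
    rw [e]
    rcases min_choice ⌊b.repr (k + p) i⌋ (hi i) with h | h
    · have hm : m i = ⌊b.repr (k + p) i⌋ := h
      rw [hm]
      exact ⟨by linarith [Int.floor_le (b.repr (k + p) i)],
        by linarith [Int.lt_floor_add_one (b.repr (k + p) i)]⟩
    · have hm : m i = hi i := h
      have hle : hi i ≤ ⌊b.repr (k + p) i⌋ := h ▸ min_le_left _ _
      rw [hm]
      refine ⟨by linarith [Int.le_floor.1 hle], ?_⟩
      rw [hsum]
      linarith [(hk i).2, (hp i).2]
  refine (measure_mono hcover).trans ((measure_biUnion_finset_le _ _).trans ?_)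
  simp [measure_vadd, volume_parallelepiped_of_span_eq hspan, hcount]

theorem exists_basis_coe_eq {z : Fin n → EuclideanSpace ℝ (Fin n)} (h : LinearIndependent ℝ z) :
    ∃ b : Basis (Fin n) ℝ (EuclideanSpace ℝ (Fin n)), ⇑b = z :=
  ⟨Basis.mk h (h.span_eq_top_of_card_eq_finrank' (by simp)).ge, Basis.coe_mk _ _⟩

/-- A translate of a unit-volume cell has volume 1, so the sublattice spanned by `b` has covolume 1
and therefore index 1 in `ℤⁿ`. -/
theorem isFundamentalCell_iff (hb : ∀ j, b j ∈ intLattice n) :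
    IsFundamentalCell (∑ j, segment ℝ 0 (b j)) ↔
      Submodule.span ℤ (range b) = intLattice n := by
  constructor
  · rintro ⟨v, c, -, hc, hspan, hP⟩
    obtain ⟨c, rfl⟩ := exists_basis_coe_eq hc
    have hvol : volume (ZSpan.fundamentalDomain b) = 1 := by
      rw [volume_fundamentalDomain_eq_parallelepiped, hP, measure_vadd,
        volume_parallelepiped_of_span_eq hspan]
    have h1 : ZLattice.covolume (Submodule.span ℤ (range b)) = 1 := by
      refine (ZLattice.covolume_eq_measure_fundamentalDomain _ volume
        (ZSpan.isAddFundamentalDomain b volume)).trans ?_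
      rw [measureReal_def, hvol, ENNReal.toReal_one]
    have h2 : ZLattice.covolume (intLattice n) = 1 := by
      refine (ZLattice.covolume_eq_measure_fundamentalDomain (intLattice n) volume
        (F := ZSpan.fundamentalDomain (EuclideanSpace.basisFun (Fin n) ℝ).toBasis)
        (.mk' (ZSpan.fundamentalDomain_measurableSet _).nullMeasurableSet
          existsUnique_vadd_mem_unitCube)).trans ?_
      rw [measureReal_def, volume_unitCube, ENNReal.toReal_one]
    have h3 := ZLattice.covolume_div_covolume_eq_relIndex' _ _ (span_le_intLattice b hb)
    rw [h1, h2, div_one] at h3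
    have h4 := AddSubgroup.relIndex_eq_one.1 (Nat.cast_eq_one.1 h3.symm)
    exact le_antisymm (span_le_intLattice b hb) h4
  · intro h
    exact ⟨0, b, zero_mem _, b.linearIndependent, h, by rw [zero_vadd]⟩

/-- The permutation and `uIcc` allow for edges listed in another order and for negative multiples of
the `b j`. -/
theorem mem_vadd_sum_segment_iff (v : EuclideanSpace ℝ (Fin n)) (σ : Equiv.Perm (Fin n))
    (s : Fin n → ℝ) (x : EuclideanSpace ℝ (Fin n)) :
    x ∈ v +ᵥ ∑ j, segment ℝ 0 (s j • b (σ j)) ↔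
      ∀ i, b.repr x i ∈ uIcc (b.repr v i) (b.repr v i + s (σ.symm i)) := by
  have hu : ∀ p s y : ℝ, y ∈ uIcc p (p + s) ↔ ∃ t ∈ Icc (0 : ℝ) 1, t * s = y - p := by
    intro p s y
    rw [← segment_eq_uIcc, segment_eq_image']
    simp only [add_sub_cancel_left, mem_image, smul_eq_mul, eq_sub_iff_add_eq']
  rw [← parallelepiped_eq_sum_segment, Set.mem_vadd_set_iff_neg_vadd_mem,
    mem_parallelepiped_iff]
  simp only [hu]
  have hrepr : ∀ t : Fin n → ℝ, ∀ i,
      b.repr (∑ j, t j • s j • b (σ j)) i = t (σ.symm i) * s (σ.symm i) := by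
    intro t i
    rw [← Equiv.sum_comp σ.symm]
    simp only [Equiv.apply_symm_apply, smul_smul]
    exact congrFun (b.repr_sum_self _) i
  constructor
  · rintro ⟨t, ht, hx⟩ i
    refine ⟨t (σ.symm i), ⟨ht.1 _, ht.2 _⟩, ?_⟩
    rw [← hrepr, ← hx, vadd_eq_add, map_add, map_neg, Finsupp.add_apply, Finsupp.neg_apply]
    ring
  · intro h
    choose t ht hts using h
    refine ⟨fun j => t (σ j), ⟨fun j => (ht _).1, fun j => (ht _).2⟩, b.ext_elem fun i => ?_⟩
    rw [hrepr, Equiv.apply_symm_apply, hts, vadd_eq_add, map_add, map_neg, Finsupp.add_apply,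
      Finsupp.neg_apply]
    ring

theorem mem_parallelFamily_of_isIntegralBox (hb : ∀ j, b j ∈ intLattice n)
    {K : Set (EuclideanSpace ℝ (Fin n))} (hK : IsIntegralBox b K) : K ∈ parallelFamily b := by
  obtain ⟨lo, hi, hlt, rfl⟩ := hK
  have hne : ∀ j, ((hi j - lo j : ℤ) : ℝ) ≠ 0 := fun j =>
    Int.cast_ne_zero.2 (sub_pos.2 (hlt j)).ne'
  refine ⟨∑ j, lo j • b j, fun j => ((hi j - lo j : ℤ) : ℝ) • b j,
    sum_mem fun j _ => (intLattice n).smul_mem _ (hb j), fun j => ?_, ?_,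
    fun j => ⟨j, _, rfl⟩, ?_⟩
  · simp only [Int.cast_smul_eq_zsmul]
    exact (intLattice n).smul_mem _ (hb j)
  · exact b.linearIndependent.units_smul fun j => Units.mk0 _ (hne j)
  · ext x
    have hv : ∀ i, b.repr (∑ j, lo j • b j) i = lo i := by
      intro i
      simp only [← Int.cast_smul_eq_zsmul ℝ]
      exact congrFun (b.repr_sum_self _) i
    have h := mem_vadd_sum_segment_iff (b := b) (∑ j, lo j • b j) (Equiv.refl _)
      (fun j => ((hi j - lo j : ℤ) : ℝ)) x
    simp only [Equiv.refl_apply] at h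
    rw [h]
    refine forall_congr' fun i => ?_
    rw [hv, Equiv.refl_symm, Equiv.refl_apply, Int.cast_sub, add_sub_cancel,
      uIcc_of_le (Int.cast_le.2 (hlt i).le)]

theorem isIntegralBox_of_mem_parallelFamily
    (hspan : Submodule.span ℤ (range b) = intLattice n)
    {K : Set (EuclideanSpace ℝ (Fin n))} (hK : K ∈ parallelFamily b) : IsIntegralBox b K := by
  obtain ⟨v, w, hv, hw, hlin, hpar, rfl⟩ := hK
  choose k s hks using hpar
  have hsurj : Function.Surjective k := by
    -- If no edge were parallel to `b m`, all `w j` would lie in the hyperplane where the `m`-th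
    -- coordinate vanishes, yet they span.
    intro m
    by_contra! hm
    have hle : Submodule.span ℝ (range w) ≤ LinearMap.ker (b.coord m) := by
      rw [Submodule.span_le]
      rintro _ ⟨j, rfl⟩
      simp [hks, hm j]
    rw [hlin.span_eq_top_of_card_eq_finrank' (by simp)] at hle
    have := hle (x := b m) trivial
    simp at this
  let σ : Equiv.Perm (Fin n) := Equiv.ofBijective k (Finite.surjective_iff_bijective.1 hsurj)
  have hint : ∀ x ∈ intLattice n, ∀ i, ∃ m : ℤ, (m : ℝ) = b.repr x i := by
    intro x hx i
    rw [← hspan, b.mem_span_iff_repr_mem ℤ] at hx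
    exact (hx i).imp fun m hm => by simpa using hm
  have hs : ∀ i, ∃ m : ℤ, (m : ℝ) = s (σ.symm i) := by
    intro i
    obtain ⟨m, hm⟩ := hint _ (hw (σ.symm i)) i
    refine ⟨m, ?_⟩
    have : k (σ.symm i) = i := σ.apply_symm_apply i
    rw [hm, hks, this]
    simp
  have hs0 : ∀ j, s j ≠ 0 := by
    intro j h0
    refine hlin.ne_zero j ?_
    rw [hks, h0, zero_smul]
  choose m hm using hs
  choose p hp using hint v hv
  refine ⟨fun i => min (p i) (p i + m i), fun i => max (p i) (p i + m i), fun i => ?_, ?_⟩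
  · have : m i ≠ 0 := fun h => hs0 (σ.symm i) (by rw [← hm, h, Int.cast_zero])
    exact min_lt_max.2 (by simpa using this)
  · ext x
    have h := mem_vadd_sum_segment_iff (b := b) v σ s x
    have e : (fun j => segment ℝ 0 (s j • b (σ j))) = fun j => segment ℝ 0 (w j) :=
      funext fun j => by rw [hks]; rfl
    simp only [e] at h
    rw [h]
    refine forall_congr' fun i => ?_
    rw [← hp, ← hm, uIcc]
    push_cast
    rfl

end Equality

end GenDavenport

theorem lemma1p1 (n : ℕ) (K : ConvexBody (EuclideanSpace ℝ (Fin n)))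
    (hK : (interior (K : Set (EuclideanSpace ℝ (Fin n)))).Nonempty)
    (z : Fin n → EuclideanSpace ℝ (Fin n))
    (hz : ∀ j, z j ∈ GenDavenport.intLattice n)
    (hlin : LinearIndependent ℝ z) :
    GenDavenport.latticeCount (K : Set (EuclideanSpace ℝ (Fin n))) ≤
        ∑ i ∈ Finset.range (n + 1), ∑ J ∈ Finset.powersetCard i (Finset.univ : Finset (Fin n)),
          GenDavenport.volIn (GenDavenport.linHull z J)ᗮ
              (GenDavenport.proj K (GenDavenport.linHull z J)ᗮ) *
            GenDavenport.volIn (GenDavenport.linHull z J)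
              (GenDavenport.subParallelepiped z J) ∧
      (GenDavenport.latticeCount (K : Set (EuclideanSpace ℝ (Fin n))) =
          ∑ i ∈ Finset.range (n + 1), ∑ J ∈ Finset.powersetCard i (Finset.univ : Finset (Fin n)),
            GenDavenport.volIn (GenDavenport.linHull z J)ᗮ
                (GenDavenport.proj K (GenDavenport.linHull z J)ᗮ) *
              GenDavenport.volIn (GenDavenport.linHull z J)
                (GenDavenport.subParallelepiped z J) ↔
        GenDavenport.IsFundamentalCell (∑ j, segment ℝ 0 (z j)) ∧
          (K : Set (EuclideanSpace ℝ (Fin n))) ∈ GenDavenport.parallelFamily z) := by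
  obtain ⟨b, rfl⟩ := GenDavenport.exists_basis_coe_eq hlin
  rw [GenDavenport.sum_volIn_eq_volume b K.isCompact K.convex,
    GenDavenport.isFundamentalCell_iff hz]
  have hle := GenDavenport.latticeCount_le_volume b hz K.isCompact
  refine ⟨hle, fun heq => ?_, fun ⟨hspan, hpar⟩ => hle.antisymm ?_⟩
  · obtain ⟨hspan, hbox⟩ := GenDavenport.span_eq_and_isIntegralBox_of_latticeCount_eq hz
      K.isCompact K.convex hK heq
    exact ⟨hspan, GenDavenport.mem_parallelFamily_of_isIntegralBox hz hbox⟩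
  · exact GenDavenport.volume_le_latticeCount hspan K.isCompact
      (GenDavenport.isIntegralBox_of_mem_parallelFamily hspan hpar)
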